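/- Let $M$ be an effect module: an effect algebra $(M,\ovee,0,1,(-)^\perp)$, possibly with $0=1$, with a scalar multiplication by $[0,1]$ such that $1x=x$, $(rs)x=r(sx)$, $(r+s)x=rx\ovee sx$ if $r+s\le 1$, and $r(x\ovee y)=rx\ovee ry$ if $x\perp y$ (i.e. if $x\ovee y$ is defined). Write $x\le y$ iff $x\ovee z=y$ for some $z$. An effect module is Archimedean if $x\le y$ whenever $\frac12x\le\frac12y\ovee\frac r2 1$ for all $r\in(0,1]$. Put $$d(x,y)=\max\Big(\inf\{r\in(0,1]\mid \tfrac12x\le\tfrac12y\ovee\tfrac r2 1\},\ \inf\{r\in(0,1]\mid \tfrac12y\le\tfrac12x\ovee\tfrac r2 1\}\Big),$$ which is a metric on an Archimedean effect module. A Banach effect module is an Archimedean effect module that is complete for $d$. A map of effect modules preserves $1$, scalar multiplication, and all defined sums. Let $S_M$ be the convex compact Hausdorff space of states, i.e. of effect module maps $M\to[0,1]$, with pointwise convex combinations and the topology of pointwise convergence. Let $\mathcal A(S_M,[0,1])$ be the effect module of affine continuous functions $S_M\to[0,1]$ with pointwise structure, and let $\varepsilon\colon M\to\mathcal A(S_M,[0,1])$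 be the evaluation map $\varepsilon(y)(g)=g(y)$, which is a map of effect modules. Then: 1. $\mathcal A(S_M,[0,1])$ is a Banach effect module. 2. The image of $\varepsilon$ is dense in $\mathcal A(S_M,[0,1])$ for the metric $d$. If $M$ is Archimedean, then $\varepsilon$ is moreover an embedding: it is injective, $\varepsilon(x)\perp\varepsilon(y)$ implies $x\perp y$, and $d(\varepsilon(x),\varepsilon(y))=d(x,y)$ for all $x,y\in M$. 3. $\varepsilon$ is an isomorphism of effect modules if and only if $M$ is a Banach effect module. -/

import Mathlib

universe u v w

/-! ### Effect algebras and effect modules -/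

/-- An effect algebra. The partial sum `x ⊕ y` is `osum x y : Option E`, with value `none` when the
sum is undefined. -/
class EffectAlgebra (E : Type u) extends Zero E, One E where
  osum : E → E → Option E
  osum_comm : ∀ x y, osum x y = osum y x
  /-- Associativity: one side is defined iff the other is, and then they agree. -/
  osum_assoc : ∀ x y z,
    (osum x y).bind (fun w => osum w z) = (osum y z).bind (fun w => osum x w)
  zero_osum : ∀ x, osum 0 x = some x
  /-- The orthosupplement. -/
  ocompl : E → E
  osum_eq_one_iff : ∀ x y, osum x y = some 1 ↔ y = ocompl x
  ocompl_zero : ocompl 0 = 1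
  eq_zero_of_osum_one : ∀ x, (osum x 1).isSome → x = 0

namespace EffectAlgebra

variable {E : Type u} [EffectAlgebra E]

/-- `x ⊥ y`: the sum of `x` and `y` is defined. -/
def Orth (x y : E) : Prop := (osum x y).isSome

/-- The order of an effect algebra: `x ≤ y` iff `x ⊕ z = y` for some `z`. -/
def Le (x y : E) : Prop := ∃ z, osum x z = some y

end EffectAlgebra

open EffectAlgebra in
/-- An effect module: an effect algebra with a bihomomorphic action of the unit interval. -/
class EffectModule (E : Type u) extends EffectAlgebra E, SMul unitInterval E where
  one_smul : ∀ x : E, (1 : unitInterval) • x = x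
  mul_smul : ∀ (r s : unitInterval) (x : E), (r * s) • x = r • (s • x)
  add_smul : ∀ (r s t : unitInterval) (x : E), (r : ℝ) + s = t →
    osum (r • x) (s • x) = some (t • x)
  smul_osum : ∀ (r : unitInterval) (x y z : E), osum x y = some z →
    osum (r • x) (r • y) = some (r • z)

/-- Homomorphisms of effect modules. -/
structure EModHom (M : Type u) (N : Type v) [EffectModule M] [EffectModule N] where
  toFun : M → N
  map_one : toFun 1 = 1
  map_smul : ∀ (r : unitInterval) (x : M), toFun (r • x) = r • toFun x
  map_osum : ∀ x y z : M, EffectAlgebra.osum x y = some z →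
    EffectAlgebra.osum (toFun x) (toFun y) = some (toFun z)

instance (M : Type u) (N : Type v) [EffectModule M] [EffectModule N] :
    CoeFun (EModHom M N) (fun _ => M → N) := ⟨EModHom.toFun⟩

theorem EModHom.ext' {M : Type u} {N : Type v} [EffectModule M] [EffectModule N]
    {f g : EModHom M N} (h : ∀ x, f x = g x) : f = g := by
  cases f; cases g; congr; exact funext h

/-- Isomorphisms in the category of effect modules. -/
def EModHom.IsIso {M : Type u} {N : Type v} [EffectModule M] [EffectModule N]
    (f : EModHom M N) : Prop :=
  ∃ g : EModHom N M, (∀ x, g (f x) = x) ∧ ∀ y, f (g y) = y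

/-! ### Archimedean and Banach effect modules -/

namespace EffectModule

/-- The scalar `1/2`. -/
noncomputable def half : unitInterval := ⟨1 / 2, by norm_num, by norm_num⟩

variable {M : Type u} [EffectModule M]

/-- The relation `½ x ≤ ½ y ⊕ (r/2) 1`. -/
def HalfLe (x y : M) (r : unitInterval) : Prop :=
  ∃ w, EffectAlgebra.osum (half • y) ((half * r) • (1 : M)) = some w ∧
    EffectAlgebra.Le (half • x) w

variable (M) in
/-- Archimedean effect modules. -/
def IsArchimedean : Prop :=
  ∀ x y : M, (∀ r : unitInterval, 0 < r → HalfLe x y r) → EffectAlgebra.Le x y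

/-- The distance `d(x, y)` of an effect module, the maximum of
`inf {r ∈ (0,1] | ½ x ≤ ½ y ⊕ (r/2) 1}` and `inf {r ∈ (0,1] | ½ y ≤ ½ x ⊕ (r/2) 1}`. -/
noncomputable def emDist (x y : M) : ℝ :=
  max (sInf ((fun r : unitInterval => (r : ℝ)) '' {r | 0 < r ∧ HalfLe x y r}))
    (sInf ((fun r : unitInterval => (r : ℝ)) '' {r | 0 < r ∧ HalfLe y x r}))

variable (M) in
/-- Every Cauchy sequence for `emDist` converges. -/
def IsMetricComplete : Prop :=
  ∀ a : ℕ → M,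
    (∀ ε : ℝ, 0 < ε → ∃ N, ∀ m ≥ N, ∀ n ≥ N, emDist (a m) (a n) < ε) →
    ∃ x : M, ∀ ε : ℝ, 0 < ε → ∃ N, ∀ n ≥ N, emDist (a n) x < ε

variable (M) in
/-- Banach effect modules: Archimedean and complete in their metric. -/
def IsBanach : Prop := IsArchimedean M ∧ IsMetricComplete M

end EffectModule

/-- The image of `f` is dense for the distance of the codomain. -/
def EModHom.HasDenseImage {M : Type u} {N : Type v} [EffectModule M] [EffectModule N]
    (f : EModHom M N) : Prop :=
  ∀ y : N, ∀ ε : ℝ, 0 < ε → ∃ x : M, EffectModule.emDist (f x) y < ε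

/-- An embedding of effect modules: an injective homomorphism that reflects the definedness of sums
(so it identifies its domain with a sub effect module of the codomain, and reflects the order) and
preserves the distance. -/
structure EModHom.IsEmbedding {M : Type u} {N : Type v} [EffectModule M] [EffectModule N]
    (f : EModHom M N) : Prop where
  injective : Function.Injective f.toFun
  reflects_orth : ∀ x y : M, EffectAlgebra.Orth (f x) (f y) → EffectAlgebra.Orth x y
  isometric : ∀ x y : M, EffectModule.emDist (f x) (f y) = EffectModule.emDist x y

/-! ### The unit interval -/

open Classical in
/-- The partial sum on `[0,1]`: `r + s`, defined when `r + s ≤ 1`. -/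
noncomputable def unitOsum (r s : unitInterval) : Option unitInterval :=
  if h : (r : ℝ) + s ≤ 1 then some ⟨(r : ℝ) + s, add_nonneg r.2.1 s.2.1, h⟩ else none

theorem unitOsum_eq_some {r s t : unitInterval} :
    unitOsum r s = some t ↔ (r : ℝ) + s = t := by
  unfold unitOsum
  split_ifs with h
  · simp [Subtype.ext_iff]
  · simp only [false_iff]
    intro h'
    exact h (h' ▸ t.2.2)

theorem unitOsum_assoc (x y z : unitInterval) :
    (unitOsum x y).bind (fun w => unitOsum w z) = (unitOsum y z).bind (fun w => unitOsum x w) := by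
  ext t
  simp only [Option.bind_eq_some_iff, unitOsum_eq_some]
  constructor
  · rintro ⟨a, ha, hb⟩
    have := x.2.1
    have := y.2.1
    have := z.2.1
    have := t.2.2
    exact ⟨⟨(y : ℝ) + z, by linarith, by linarith⟩, rfl, by simp only; linarith⟩
  · rintro ⟨a, ha, hb⟩
    have := x.2.1
    have := y.2.1
    have := z.2.1
    have := t.2.2
    exact ⟨⟨(x : ℝ) + y, by linarith, by linarith⟩, rfl, by simp only; linarith⟩

noncomputable instance : EffectModule unitInterval where
  osum := unitOsum
  osum_comm x y := by ext t; simp only [unitOsum_eq_some, add_comm]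
  osum_assoc := unitOsum_assoc
  zero_osum x := by simp [unitOsum_eq_some]
  ocompl := unitInterval.symm
  osum_eq_one_iff x y := by
    rw [unitOsum_eq_some, Subtype.ext_iff, unitInterval.coe_symm_eq]
    change (x : ℝ) + y = 1 ↔ _
    constructor <;> intro h <;> linarith
  ocompl_zero := unitInterval.symm_zero
  eq_zero_of_osum_one x h := by
    obtain ⟨t, ht⟩ := Option.isSome_iff_exists.1 h
    rw [unitOsum_eq_some] at ht
    replace ht : (x : ℝ) + 1 = t := ht
    have := x.2.1
    have := t.2.2
    exact Subtype.ext (by change (x : ℝ) = 0; linarith)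
  smul r x := r * x
  one_smul x := one_mul x
  mul_smul r s x := mul_assoc r s x
  add_smul r s t x h := by
    rw [unitOsum_eq_some]
    change (r : ℝ) * x + s * x = t * x
    rw [← h]; ring
  smul_osum r x y z h := by
    rw [unitOsum_eq_some] at h ⊢
    change (r : ℝ) * x + r * y = r * z
    rw [← h]; ring

/-! ### The space of states -/

/-- The states of `M`: effect module homomorphisms `M → [0,1]`. -/
abbrev EModState (M : Type u) [EffectModule M] : Type u := EModHom M unitInterval

namespace EModState

variable {M : Type u} [EffectModule M]

/-- The topology of pointwise convergence (weak-* topology) on states. -/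
instance : TopologicalSpace (EModState M) :=
  TopologicalSpace.induced (fun k : EModState M => (k.toFun : M → unitInterval)) inferInstance

theorem osum_iff {r s t : unitInterval} :
    EffectAlgebra.osum r s = some t ↔ (r : ℝ) + s = t := unitOsum_eq_some

open Convexity in
/-- A pointwise convex combination of elements of the unit interval lies in the unit interval. -/
theorem comb_mem (p : StdSimplex ℝ (EModState M)) (x : M) :
    (p.weights.sum fun k r => r * (k x : ℝ)) ∈ unitInterval := by
  constructor
  · exact Finset.sum_nonneg fun k _ => mul_nonneg (p.nonneg k) (k x).2.1
  · calc (p.weights.sum fun k r => r * (k x : ℝ)) ≤ p.weights.sum fun _ r => r :=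
          Finset.sum_le_sum fun k _ => mul_le_of_le_one_right (p.nonneg k) (k x).2.2
      _ = 1 := p.total

open Convexity in
/-- The pointwise convex combination `∑ rᵢ kᵢ` of states. -/
noncomputable def comb (p : StdSimplex ℝ (EModState M)) : EModState M where
  toFun x := ⟨p.weights.sum fun k r => r * (k x : ℝ), comb_mem p x⟩
  map_one := by
    refine Subtype.ext ?_
    simp [EModHom.map_one]
  map_smul r x := by
    refine Subtype.ext ?_
    change (p.weights.sum fun k s => s * (k (r • x) : ℝ))
      = (r : ℝ) * p.weights.sum fun k s => s * (k x : ℝ)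
    rw [Finsupp.mul_sum]
    refine Finset.sum_congr rfl fun k _ => ?_
    have h : (k (r • x) : ℝ) = r * k x := by rw [k.map_smul]; rfl
    simp only [h]; ring
  map_osum x y z h := by
    rw [osum_iff]
    change (p.weights.sum fun k s => s * (k x : ℝ)) + (p.weights.sum fun k s => s * (k y : ℝ))
      = p.weights.sum fun k s => s * (k z : ℝ)
    rw [← Finsupp.sum_add]
    refine Finset.sum_congr rfl fun k _ => ?_
    simp only [← osum_iff.1 (k.map_osum x y z h)]; ring

open Convexity in
/-- The convex structure on states, given by pointwise convex combinations. -/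
noncomputable instance : ConvexSpace ℝ (EModState M) :=
  ConvexSpace.mk comb
    (fun k => EModHom.ext' fun x => Subtype.ext (by simp [comb]))
    (fun f => EModHom.ext' fun x => Subtype.ext (by
      simp only [comb, StdSimplex.weights_map, StdSimplex.weights_sConvexComb]
      rw [Finsupp.sum_mapDomain_index (by simp) (by intros; ring),
        Finsupp.sum_sum_index (by simp) (by intros; ring)]
      refine Finset.sum_congr rfl fun p _ => ?_
      simp only [comb]
      rw [Finsupp.sum_smul_index (by simp), Finsupp.mul_sum]
      simp only [mul_assoc]))

instance : T2Space (EModState M) :=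
  T2Space.of_injective_continuous (f := fun k : EModState M => (k.toFun : M → unitInterval))
    (fun _ _ h => EModHom.ext' (congrFun h)) continuous_induced_dom

instance : CompactSpace (EModState M) := by
  have hi : Topology.IsInducing (fun k : EModState M => (k.toFun : M → unitInterval)) := ⟨rfl⟩
  have hr : Set.range (fun k : EModState M => (k.toFun : M → unitInterval)) =
      {g | g 1 = 1} ∩ (⋂ (r : unitInterval) (x : M), {g | (g (r • x) : ℝ) = r * g x}) ∩
      (⋂ (x : M) (y : M) (z : M) (_ : EffectAlgebra.osum x y = some z),
        {g | (g x : ℝ) + g y = g z}) := by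
    ext g
    simp only [Set.mem_range, Set.mem_inter_iff, Set.mem_iInter, Set.mem_ofPred_eq]
    constructor
    · rintro ⟨k, rfl⟩
      refine ⟨⟨k.map_one, fun r x => ?_⟩, fun x y z h => osum_iff.1 (k.map_osum x y z h)⟩
      rw [k.map_smul]; rfl
    · rintro ⟨⟨h1, h2⟩, h3⟩
      exact ⟨⟨g, h1, fun r x => Subtype.ext (h2 r x), fun x y z h => osum_iff.2 (h3 x y z h)⟩, rfl⟩
  have hc : IsClosed (Set.range (fun k : EModState M => (k.toFun : M → unitInterval))) := by
    rw [hr]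
    refine ((isClosed_eq (by fun_prop) (by fun_prop)).inter ?_).inter ?_
    · exact isClosed_iInter fun r => isClosed_iInter fun x =>
        isClosed_eq (by fun_prop) (by fun_prop)
    · exact isClosed_iInter fun x => isClosed_iInter fun y => isClosed_iInter fun z =>
        isClosed_iInter fun _ => isClosed_eq (by fun_prop) (by fun_prop)
  rw [← isCompact_univ_iff, hi.isCompact_iff, Set.image_univ]
  exact hc.isCompact

end EModState

/-! ### Affine continuous functions -/

theorem isAffineMap_real_iff {X : Type u} [Convexity.ConvexSpace ℝ X] {f : X → ℝ} :
    Convexity.IsAffineMap ℝ f ↔ ∀ s : Convexity.StdSimplex ℝ X,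
      f (Convexity.ConvexSpace.sConvexComb s) = s.weights.sum fun x r => r * f x := by
  have key : ∀ s : Convexity.StdSimplex ℝ X,
      Convexity.ConvexSpace.sConvexComb (s.map f) = s.weights.sum fun x r => r * f x := by
    intro s
    rw [Convexity.sConvexComb_eq_sum, Convexity.StdSimplex.weights_map,
      Finsupp.sum_mapDomain_index (by simp) (by intros; simp [add_mul])]
    rfl
  exact ⟨fun h s => (h.map_sConvexComb s).trans (key s), fun h => ⟨fun s => (h s).trans (key s).symm⟩⟩

/-- `𝒜(X, [0,1])`: the affine continuous functions `X → [0,1]` on a convex topological space. -/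
structure AffineCont (X : Type u) [TopologicalSpace X] [Convexity.ConvexSpace ℝ X] where
  toFun : X → unitInterval
  continuous_toFun : Continuous toFun
  affine_toFun : Convexity.IsAffineMap ℝ (fun x => (toFun x : ℝ))

namespace AffineCont

variable {X : Type u} [TopologicalSpace X] [Convexity.ConvexSpace ℝ X]

instance : CoeFun (AffineCont X) (fun _ => X → unitInterval) := ⟨AffineCont.toFun⟩

theorem ext' {p q : AffineCont X} (h : ∀ x, (p x : ℝ) = q x) : p = q := by
  cases p; cases q; congr; exact funext fun x => Subtype.ext (h x)

/-- The pointwise sum `p + q`, given that `p + q ≤ 1` pointwise. -/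
noncomputable def add (p q : AffineCont X) (h : ∀ x, (p x : ℝ) + q x ≤ 1) : AffineCont X where
  toFun x := ⟨(p x : ℝ) + q x, add_nonneg (p x).2.1 (q x).2.1, h x⟩
  continuous_toFun := Continuous.subtype_mk
    ((continuous_subtype_val.comp p.continuous_toFun).add
      (continuous_subtype_val.comp q.continuous_toFun)) _
  affine_toFun := isAffineMap_real_iff.2 fun s => by
    simp only [isAffineMap_real_iff.1 p.affine_toFun s, isAffineMap_real_iff.1 q.affine_toFun s,
      mul_add, Finsupp.sum_add]

open Classical in
/-- The pointwise partial sum: defined when `p + q ≤ 1` pointwise. -/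
noncomputable def osum (p q : AffineCont X) : Option (AffineCont X) :=
  if h : ∀ x, (p x : ℝ) + q x ≤ 1 then some (add p q h) else none

theorem osum_eq_some {p q t : AffineCont X} :
    osum p q = some t ↔ ∀ x, (p x : ℝ) + q x = t x := by
  unfold osum
  split_ifs with h
  · rw [Option.some_inj]
    constructor
    · rintro rfl x; rfl
    · exact fun h' => ext' h'
  · simp only [false_iff]
    exact fun h' => h fun x => (h' x).symm ▸ (t x).2.2

/-- The constant function with value `r`. -/
def const (X : Type u) [TopologicalSpace X] [Convexity.ConvexSpace ℝ X] (r : unitInterval) :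
    AffineCont X where
  toFun _ := r
  continuous_toFun := continuous_const
  affine_toFun := Convexity.IsAffineMap.const _

/-- The pointwise orthosupplement `1 - p`. -/
noncomputable def compl (p : AffineCont X) : AffineCont X where
  toFun x := unitInterval.symm (p x)
  continuous_toFun := unitInterval.continuous_symm.comp p.continuous_toFun
  affine_toFun := isAffineMap_real_iff.2 fun s => by
    simp only [unitInterval.coe_symm_eq, isAffineMap_real_iff.1 p.affine_toFun s,
      mul_sub, mul_one, Finsupp.sum_sub, s.total]

/-- The pointwise scalar multiple `r p`. -/
noncomputable def smul (r : unitInterval) (p : AffineCont X) : AffineCont X where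
  toFun x := r * p x
  continuous_toFun := continuous_const.mul p.continuous_toFun
  affine_toFun := isAffineMap_real_iff.2 fun s => by
    simp only [Set.Icc.coe_mul, isAffineMap_real_iff.1 p.affine_toFun s, Finsupp.mul_sum,
      mul_left_comm]

/-- The effect module structure on `𝒜(X, [0,1])`, inherited pointwise from `[0,1]`. -/
noncomputable instance : EffectModule (AffineCont X) where
  zero := const X 0
  one := const X 1
  osum := osum
  osum_comm p q := by ext t; simp only [osum_eq_some, add_comm]
  osum_assoc p q s := by
    ext t
    simp only [Option.bind_eq_some_iff, osum_eq_some]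
    constructor
    · rintro ⟨a, ha, hb⟩
      refine ⟨add q s fun x => ?_, fun x => rfl, fun x => ?_⟩
      · linarith [ha x, hb x, (p x).2.1, (t x).2.2]
      · change (p x : ℝ) + (q x + s x) = t x
        linarith [ha x, hb x]
    · rintro ⟨a, ha, hb⟩
      refine ⟨add p q fun x => ?_, fun x => rfl, fun x => ?_⟩
      · linarith [ha x, hb x, (s x).2.1, (t x).2.2]
      · change ((p x : ℝ) + q x) + s x = t x
        linarith [ha x, hb x]
  zero_osum p := osum_eq_some.2 fun x => zero_add _
  ocompl := compl
  osum_eq_one_iff p q := by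
    rw [osum_eq_some]
    constructor
    · intro h
      refine ext' fun x => ?_
      have h1 : (p x : ℝ) + q x = 1 := h x
      change (q x : ℝ) = 1 - p x
      linarith
    · rintro rfl x
      change (p x : ℝ) + (1 - p x) = 1
      ring
  ocompl_zero := ext' fun x => sub_zero (1 : ℝ)
  eq_zero_of_osum_one p h := by
    obtain ⟨t, ht⟩ := Option.isSome_iff_exists.1 h
    rw [osum_eq_some] at ht
    refine ext' fun x => ?_
    have h1 : (p x : ℝ) + 1 = t x := ht x
    change (p x : ℝ) = 0
    linarith [(p x).2.1, (t x).2.2]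
  smul := smul
  one_smul p := ext' fun x => one_mul _
  mul_smul r s p := ext' fun x => mul_assoc _ _ _
  add_smul r s t p h := by
    rw [osum_eq_some]
    intro x
    change (r : ℝ) * p x + s * p x = t * p x
    rw [← h]; ring
  smul_osum r p q t h := by
    rw [osum_eq_some] at h ⊢
    intro x
    change (r : ℝ) * p x + r * q x = r * t x
    rw [← h x]; ring

end AffineCont

/-- The evaluation map `M → 𝒜(S_M, [0,1])`, sending `y` to `k ↦ k y`. -/
noncomputable def evalHom (M : Type u) [EffectModule M] :
    EModHom M (AffineCont (EModState M)) where
  toFun y :=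
    { toFun := fun k => k y
      continuous_toFun := (continuous_apply y).comp continuous_induced_dom
      affine_toFun := isAffineMap_real_iff.2 fun _ => rfl }
  map_one := AffineCont.ext' fun k => congrArg Subtype.val k.map_one
  map_smul r y := AffineCont.ext' fun k => congrArg Subtype.val (k.map_smul r y)
  map_osum x y z h :=
    AffineCont.osum_eq_some.2 fun k => EModState.osum_iff.1 (k.map_osum x y z h)

/-! Everything rests on one principle: an element of the order unit space generated by `M` that is
strictly positive on all states is positive. That space is replaced by formal real combinations of
elements of `M`, together with the cone `positiveCone M` of those made nonnegative by the effect
module laws. Two nonnegative combinations are identified when their multiples by every sufficiently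
small `t` have equal partial sums in `M`, where all sums are defined. The element 1 is an order
unit, so Riesz extension yields a state that is nonpositive on any vector outside the cone
(`mem_positiveCone_of_forall_state_pos`).

To return from the cone to `M`, take a relation at scale `s / n` and add it to itself `n` times.
This turns a combination between 0 and 1 into an element (`exists_forall_state_eq`) and a strict
inequality on states into the halved inequality of the metric (`halfLe_of_forall_state`). Hence `d`
is the supremum distance over states, and evaluation is isometric for every `M`.

For density, a Hahn–Banach hyperplane between the graphs of `f` and `f + δ` gives a combination
between the two functions; rescaled into the unit interval, it is represented by an element.
Completeness then gives surjectivity, and the Archimedean property gives reflection of order and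
sums. -/

namespace EffectAlgebra

/-! ### Cancellation and order in effect algebras. -/

variable {E : Type u} [EffectAlgebra E]

theorem osum_zero (x : E) : osum x 0 = some x := by
  rw [osum_comm, zero_osum]

theorem osum_ocompl (x : E) : osum x (ocompl x) = some 1 :=
  (osum_eq_one_iff x _).2 rfl

/-- Both `x` and `y` are the orthosupplement of `z ⊕ w^⊥`. -/
theorem osum_right_cancel {x y z w : E} (h₁ : osum x z = some w) (h₂ : osum y z = some w) :
    x = y := by
  have h₃ := osum_assoc x z (ocompl w)
  have h₄ := osum_assoc y z (ocompl w)
  rw [h₁, Option.bind_some, osum_ocompl] at h₃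
  rw [h₂, Option.bind_some, osum_ocompl] at h₄
  obtain ⟨a, ha, hxa⟩ := Option.bind_eq_some_iff.1 h₃.symm
  obtain ⟨b, hb, hyb⟩ := Option.bind_eq_some_iff.1 h₄.symm
  obtain rfl : a = b := Option.some_injective _ (ha.symm.trans hb)
  rw [osum_comm, osum_eq_one_iff] at hxa hyb
  rw [hxa, hyb]

theorem right_eq_zero_of_osum_eq_zero {x y : E} (h : osum x y = some 0) : y = 0 := by
  have h₁ := osum_assoc x y 1
  rw [h, Option.bind_some, zero_osum] at h₁
  obtain ⟨a, ha, -⟩ := Option.bind_eq_some_iff.1 h₁.symm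
  exact eq_zero_of_osum_one y (by rw [ha]; rfl)

theorem Le.antisymm {x y : E} (h₁ : Le x y) (h₂ : Le y x) : x = y := by
  obtain ⟨a, ha⟩ := h₁
  obtain ⟨b, hb⟩ := h₂
  have h := osum_assoc x a b
  rw [ha, Option.bind_some, hb] at h
  obtain ⟨c, hc, hxc⟩ := Option.bind_eq_some_iff.1 h.symm
  obtain rfl : c = 0 := by
    rw [osum_comm] at hxc
    exact osum_right_cancel hxc (zero_osum x)
  obtain rfl : b = 0 := right_eq_zero_of_osum_eq_zero hc
  rw [osum_zero] at hb
  exact (Option.some_injective _ hb).symm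

/-- Reduces reflection of sums to reflection of order. -/
theorem orth_iff_le_ocompl {x y : E} : Orth x y ↔ Le x (ocompl y) := by
  constructor
  · intro h
    obtain ⟨z, hz⟩ := Option.isSome_iff_exists.1 h
    refine ⟨ocompl z, ?_⟩
    have h₁ := osum_assoc y x (ocompl z)
    rw [osum_comm y x, hz, Option.bind_some, osum_ocompl] at h₁
    obtain ⟨a, ha, hya⟩ := Option.bind_eq_some_iff.1 h₁.symm
    rw [osum_eq_one_iff] at hya
    rw [ha, hya]
  · rintro ⟨z, hz⟩
    have h₁ := osum_assoc z x y
    rw [osum_comm z x, hz, Option.bind_some, osum_comm _ y, osum_ocompl] at h₁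
    obtain ⟨a, ha, -⟩ := Option.bind_eq_some_iff.1 h₁.symm
    exact Option.isSome_iff_exists.2 ⟨a, ha⟩

end EffectAlgebra

/-! ### The monoid of partial sums. -/

open EffectAlgebra

/-- An effect algebra with an absorbing element `none` adjoined, standing for an undefined sum.
It is a commutative monoid, so that iterated partial sums are finite sums in it. -/
def PartialSum (E : Type u) : Type u := Option E

namespace PartialSum

variable {E : Type u}

/-- The inclusion of an effect algebra into its monoid of partial sums. -/
def of (x : E) : PartialSum E := some x

theorem of_injective : Function.Injective (of : E → PartialSum E) := Option.some_injective _

theorem ext_of {a b : PartialSum E} (h : ∀ z, a = of z ↔ b = of z) : a = b :=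
  Option.ext h

variable [EffectAlgebra E]

/-- Addition in the monoid of partial sums. -/
def sum (a b : PartialSum E) : PartialSum E :=
  Option.bind a fun x => Option.bind b fun y => osum x y

theorem sum_eq_some {a b : PartialSum E} {z : E} :
    sum a b = of z ↔ ∃ x y, a = of x ∧ b = of y ∧ osum x y = some z := by
  constructor
  · intro h
    obtain ⟨x, hx, h⟩ := Option.bind_eq_some_iff.1 h
    obtain ⟨y, hy, h⟩ := Option.bind_eq_some_iff.1 h
    exact ⟨x, y, hx, hy, h⟩
  · rintro ⟨x, y, rfl, rfl, h⟩
    exact h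

instance : Zero (PartialSum E) := ⟨of 0⟩

instance : Add (PartialSum E) := ⟨sum⟩

instance : AddCommMonoid (PartialSum E) where
  zero_add a := by
    refine ext_of fun z => ?_
    change sum (of 0) a = _ ↔ _
    rw [sum_eq_some]
    constructor
    · rintro ⟨x, y, hx, rfl, h⟩
      rw [← of_injective hx, zero_osum] at h
      exact h
    · rintro rfl
      exact ⟨0, z, rfl, rfl, zero_osum z⟩
  add_zero a := by
    refine ext_of fun z => ?_
    change sum a (of 0) = _ ↔ _
    rw [sum_eq_some]
    constructor
    · rintro ⟨x, y, rfl, hy, h⟩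
      rw [← of_injective hy, osum_zero] at h
      exact h
    · rintro rfl
      exact ⟨z, 0, rfl, rfl, osum_zero z⟩
  add_comm a b := by
    refine ext_of fun z => ?_
    change sum a b = _ ↔ sum b a = _
    rw [sum_eq_some, sum_eq_some]
    constructor <;>
    · rintro ⟨x, y, hx, hy, h⟩
      exact ⟨y, x, hy, hx, by rwa [osum_comm]⟩
  add_assoc a b c := by
    refine ext_of fun z => ?_
    change sum (sum a b) c = _ ↔ sum a (sum b c) = _
    rw [sum_eq_some, sum_eq_some]
    constructor
    · rintro ⟨w, k, hw, rfl, h⟩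
      obtain ⟨x, y, rfl, rfl, hxy⟩ := sum_eq_some.1 hw
      have := osum_assoc x y k
      rw [hxy, Option.bind_some, h] at this
      obtain ⟨v, hv, hxv⟩ := Option.bind_eq_some_iff.1 this.symm
      exact ⟨x, v, rfl, hv, hxv⟩
    · rintro ⟨x, w, rfl, hw, h⟩
      obtain ⟨y, k, rfl, rfl, hyk⟩ := sum_eq_some.1 hw
      have := osum_assoc x y k
      rw [hyk, Option.bind_some, h] at this
      obtain ⟨v, hv, hxv⟩ := Option.bind_eq_some_iff.1 this
      exact ⟨v, k, hv, rfl, hxv⟩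
  nsmul := nsmulRec

theorem of_zero : (of 0 : PartialSum E) = 0 := rfl

theorem add_eq_of {a b : PartialSum E} {z : E} :
    a + b = of z ↔ ∃ x y, a = of x ∧ b = of y ∧ osum x y = some z := sum_eq_some

theorem of_add_of {x y z : E} : of x + of y = of z ↔ osum x y = some z := Iff.rfl

/-- Since `none` is absorbing, cancellation needs the total to be defined. -/
theorem add_right_cancel_of {a b c : PartialSum E} {w : E} (h₁ : a + c = of w)
    (h₂ : b + c = of w) : a = b := by
  obtain ⟨x, z, rfl, rfl, hx⟩ := add_eq_of.1 h₁
  obtain ⟨y, z', rfl, hz', hy⟩ := add_eq_of.1 h₂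
  rw [← of_injective hz'] at hy
  rw [osum_right_cancel hx hy]

end PartialSum

/-! ### Real multiples, states and subconvex combinations. -/

namespace EffectModule

variable {M : Type u} [EffectModule M]

/-- The scalar in `[0,1]` nearest to a real number. -/
noncomputable def clamp (a : ℝ) : unitInterval := Set.projIcc 0 1 zero_le_one a

theorem coe_clamp {a : ℝ} (h₀ : 0 ≤ a) (h₁ : a ≤ 1) : (clamp a : ℝ) = a := by
  rw [clamp, Set.projIcc_of_mem zero_le_one ⟨h₀, h₁⟩]

theorem clamp_coe (r : unitInterval) : clamp (r : ℝ) = r :=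
  Subtype.ext (coe_clamp r.2.1 r.2.2)

theorem clamp_mul {a b : ℝ} (ha₀ : 0 ≤ a) (ha₁ : a ≤ 1) (hb₀ : 0 ≤ b) (hb₁ : b ≤ 1) :
    clamp (a * b) = clamp a * clamp b := by
  refine Subtype.ext ?_
  rw [Set.Icc.coe_mul, coe_clamp ha₀ ha₁, coe_clamp hb₀ hb₁,
    coe_clamp (mul_nonneg ha₀ hb₀) (mul_le_one₀ ha₁ hb₀ hb₁)]

theorem zero_smul (x : M) : (0 : unitInterval) • x = 0 := by
  have h := add_smul 0 0 0 x (by simp)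
  exact osum_right_cancel h (zero_osum _)

/-- The multiple of an element by a real scalar in `[0,1]`, as a partial sum. -/
noncomputable def scale (a : ℝ) (x : M) : PartialSum M := PartialSum.of (clamp a • x)

theorem scale_coe (r : unitInterval) (x : M) : scale (r : ℝ) x = PartialSum.of (r • x) := by
  rw [scale, clamp_coe]

theorem scale_zero (x : M) : scale 0 x = 0 := by
  have h := scale_coe 0 x
  rwa [zero_smul] at h

theorem scale_one (x : M) : scale 1 x = PartialSum.of x := by
  have h := scale_coe 1 x
  rwa [one_smul] at h

theorem scale_add {a b : ℝ} (ha : 0 ≤ a) (hb : 0 ≤ b) (hab : a + b ≤ 1) (x : M) :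
    scale (a + b) x = scale a x + scale b x := by
  symm
  refine PartialSum.of_add_of.2 (add_smul _ _ _ x ?_)
  rw [coe_clamp ha (by linarith), coe_clamp hb (by linarith), coe_clamp (by linarith) hab]

theorem scale_osum (a : ℝ) {x y z : M} (h : osum x y = some z) :
    scale a x + scale a y = scale a z :=
  PartialSum.of_add_of.2 (smul_osum _ x y z h)

theorem scale_smul {a : ℝ} (ha₀ : 0 ≤ a) (ha₁ : a ≤ 1) (r : unitInterval) (x : M) :
    scale a (r • x) = scale (a * r) x := by
  rw [scale, scale, clamp_mul ha₀ ha₁ r.2.1 r.2.2, clamp_coe, mul_smul]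

theorem nsmul_scale {a : ℝ} (ha : 0 ≤ a) (n : ℕ) (hn : n * a ≤ 1) (x : M) :
    n • scale a x = scale (n * a) x := by
  induction n with
  | zero => simp [scale_zero]
  | succ n ih =>
    push_cast at hn ⊢
    rw [succ_nsmul, ih (by linarith), add_mul, one_mul,
      scale_add (by positivity) ha (by linarith)]

theorem coe_state_smul (k : EModState M) (r : unitInterval) (x : M) :
    (k (r • x) : ℝ) = r * k x := by
  rw [k.map_smul]; rfl

theorem coe_state_one (k : EModState M) : (k 1 : ℝ) = 1 := by
  rw [k.map_one]; rfl

theorem coe_state_osum (k : EModState M) {x y z : M} (h : osum x y = some z) :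
    (k x : ℝ) + k y = k z :=
  EModState.osum_iff.1 (k.map_osum x y z h)

theorem coe_state_le (k : EModState M) {x y : M} (h : Le x y) : (k x : ℝ) ≤ k y := by
  obtain ⟨z, hz⟩ := h
  linarith [coe_state_osum k hz, (k z).2.1]

theorem coe_state_ocompl (k : EModState M) (x : M) : (k (ocompl x) : ℝ) = 1 - k x := by
  linarith [coe_state_osum k (osum_ocompl x), coe_state_one k]

theorem coe_state_nsmul (k : EModState M) {x y : M} {n : ℕ}
    (h : n • PartialSum.of x = PartialSum.of y) : (k y : ℝ) = n * k x := by
  induction n generalizing y with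
  | zero =>
    rw [zero_nsmul, ← PartialSum.of_zero] at h
    rw [← PartialSum.of_injective h]
    have h₀ := coe_state_osum k (zero_osum (0 : M))
    push_cast
    linarith
  | succ n ih =>
    rw [succ_nsmul] at h
    obtain ⟨a, b, ha, hb, hab⟩ := PartialSum.add_eq_of.1 h
    rw [← PartialSum.of_injective hb] at hab
    rw [← coe_state_osum k hab, ih ha]
    push_cast
    ring

/-- A subconvex combination of elements of an effect module exists. -/
theorem exists_sum_scale (s : Finset M) (a : M → ℝ) (h₀ : ∀ x, 0 ≤ a x) (h₁ : ∑ x ∈ s, a x ≤ 1) :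
    ∃ y d : M, ∑ x ∈ s, scale (a x) x = PartialSum.of y ∧
      PartialSum.of y + PartialSum.of d = scale (∑ x ∈ s, a x) 1 ∧
      ∀ k : EModState M, (k y : ℝ) = ∑ x ∈ s, a x * k x := by
  classical
  induction s using Finset.induction_on with
  | empty =>
    refine ⟨0, 0, rfl, ?_, fun k => ?_⟩
    · simp [scale_zero, PartialSum.of_zero]
    · have h₀ := coe_state_osum k (zero_osum (0 : M))
      simp only [Finset.sum_empty]
      linarith
  | insert x s hx ih =>
    rw [Finset.sum_insert hx] at h₁
    have hs : 0 ≤ ∑ x ∈ s, a x := Finset.sum_nonneg fun x _ => h₀ x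
    obtain ⟨y, d, hy, hd, hk⟩ := ih (by linarith [h₀ x])
    -- The remainder `d` is carried through the induction because a part of a defined sum is
    -- defined: the four terms add up to a multiple of 1.
    have h : (scale (a x) x + PartialSum.of y) + (scale (a x) (ocompl x) + PartialSum.of d) =
        scale (a x + ∑ x ∈ s, a x) 1 := by
      rw [scale_add (h₀ x) hs h₁, ← hd, ← scale_osum (a x) (osum_ocompl x)]
      abel
    obtain ⟨y', d', hy', hd', h'⟩ := PartialSum.add_eq_of.1 h
    refine ⟨y', d', ?_, ?_, fun k => ?_⟩
    · rw [Finset.sum_insert hx, hy, hy']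
    · rw [Finset.sum_insert hx, ← h, hy', hd']
    · rw [Finset.sum_insert hx, ← coe_state_osum k (PartialSum.of_add_of.1 hy'), hk,
        coe_state_smul, coe_clamp (h₀ x) (by linarith)]

end EffectModule

/-! ### Formal combinations and their positive cone. -/

namespace EffectModule
open Filter Topology

variable {M : Type u} [EffectModule M]

/-- The partial sum `∑ (t cₓ) x` in an effect module, for a formal combination `c` and a (small)
scaling factor `t`. -/
noncomputable def scaledSum (c : M →₀ ℝ) (t : ℝ) : PartialSum M :=
  c.sum fun x a => scale (t * a) x

theorem scaledSum_eq_sum {c : M →₀ ℝ} {s : Finset M} (hs : c.support ⊆ s) (t : ℝ) :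
    scaledSum c t = ∑ x ∈ s, scale (t * c x) x :=
  Finsupp.sum_of_support_subset _ hs _ fun x _ => by rw [mul_zero, scale_zero]

theorem scaledSum_single (x : M) (a t : ℝ) :
    scaledSum (Finsupp.single x a) t = scale (t * a) x :=
  Finsupp.sum_single_index (by rw [mul_zero, scale_zero])

theorem eventually_nhdsGT_mul_le_one (a : ℝ) : ∀ᶠ t in 𝓝[>] (0 : ℝ), t * a ≤ 1 := by
  have h : Tendsto (fun t : ℝ => t * a) (𝓝[>] 0) (𝓝 (0 * a)) :=
    ((continuous_id.mul continuous_const).tendsto 0).mono_left nhdsWithin_le_nhds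
  rw [zero_mul] at h
  exact h.eventually (Iic_mem_nhds one_pos)

/-- For small `t` all coefficients stay in the unit interval, so the clamping in `scale` has no
effect. -/
theorem scaledSum_add {a b : M →₀ ℝ} (ha : 0 ≤ a) (hb : 0 ≤ b) :
    ∀ᶠ t in 𝓝[>] (0 : ℝ), scaledSum (a + b) t = scaledSum a t + scaledSum b t := by
  classical
  have h : ∀ᶠ t in 𝓝[>] (0 : ℝ), ∀ x ∈ a.support ∪ b.support, t * (a x + b x) ≤ 1 :=
    (eventually_all_finset _).2 fun x _ => eventually_nhdsGT_mul_le_one _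
  filter_upwards [h, self_mem_nhdsWithin] with t ht ht₀
  rw [scaledSum_eq_sum Finsupp.support_add, scaledSum_eq_sum Finset.subset_union_left,
    scaledSum_eq_sum Finset.subset_union_right, ← Finset.sum_add_distrib]
  refine Finset.sum_congr rfl fun x hx => ?_
  have h₁ := ht x hx
  rw [mul_add] at h₁
  rw [Finsupp.add_apply, mul_add,
    scale_add (mul_nonneg (le_of_lt ht₀) (ha x)) (mul_nonneg (le_of_lt ht₀) (hb x)) h₁]

theorem exists_scaledSum_eq_of {c : M →₀ ℝ} (hc : 0 ≤ c) :
    ∀ᶠ t in 𝓝[>] (0 : ℝ), ∃ y : M, scaledSum c t = PartialSum.of y ∧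
      ∀ k : EModState M, (k y : ℝ) = t * Finsupp.linearCombination ℝ (fun x => (k x : ℝ)) c := by
  filter_upwards [eventually_nhdsGT_mul_le_one (∑ x ∈ c.support, c x), self_mem_nhdsWithin]
    with t ht ht₀
  obtain ⟨y, -, hy, -, hk⟩ := exists_sum_scale c.support (fun x => t * c x)
    (fun x => mul_nonneg (le_of_lt ht₀) (hc x)) (by rwa [← Finset.mul_sum])
  refine ⟨y, hy, fun k => ?_⟩
  rw [hk, Finsupp.linearCombination_apply, Finsupp.sum, Finset.mul_sum]
  exact Finset.sum_congr rfl fun x _ => mul_assoc _ _ _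

/-- Two formal combinations have the same value if their small multiples have equal sums. -/
def SameValue (a b : M →₀ ℝ) : Prop :=
  ∀ᶠ t in 𝓝[>] (0 : ℝ), scaledSum a t = scaledSum b t

theorem SameValue.refl (a : M →₀ ℝ) : SameValue a a := Eventually.of_forall fun _ => rfl

theorem SameValue.symm {a b : M →₀ ℝ} (h : SameValue a b) : SameValue b a :=
  Eventually.mono h fun _ => Eq.symm

theorem SameValue.add {a b c d : M →₀ ℝ} (ha : 0 ≤ a) (hb : 0 ≤ b) (hc : 0 ≤ c) (hd : 0 ≤ d)
    (h₁ : SameValue a b) (h₂ : SameValue c d) : SameValue (a + c) (b + d) := by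
  filter_upwards [h₁, h₂, scaledSum_add ha hc, scaledSum_add hb hd] with t h₁ h₂ h₃ h₄
  rw [h₃, h₄, h₁, h₂]

theorem SameValue.smul {a b : M →₀ ℝ} (h : SameValue a b) {r : ℝ} (hr : 0 ≤ r) :
    SameValue (r • a) (r • b) := by
  obtain rfl | hr := hr.eq_or_lt
  · simp only [_root_.zero_smul]
    exact SameValue.refl 0
  -- Scaling the combination by `r` amounts to replacing `t` by `t * r`, which still tends to 0 from
  -- above.
  have key (c : M →₀ ℝ) (t : ℝ) : scaledSum (r • c) t = scaledSum c (t * r) := by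
    rw [scaledSum, Finsupp.sum_smul_index fun x => by rw [mul_zero, scale_zero]]
    simp only [scaledSum, mul_assoc]
  have ht : Tendsto (fun t : ℝ => t * r) (𝓝[>] 0) (𝓝[>] 0) := by
    refine tendsto_nhdsWithin_iff.2 ⟨?_, ?_⟩
    · have h : Tendsto (fun t : ℝ => t * r) (𝓝[>] 0) (𝓝 (0 * r)) :=
        ((continuous_id.mul continuous_const).tendsto 0).mono_left nhdsWithin_le_nhds
      rwa [zero_mul] at h
    · filter_upwards [self_mem_nhdsWithin] with t ht
      exact mul_pos ht hr
  filter_upwards [ht.eventually h] with t h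
  rw [key, key, h]

theorem SameValue.of_add_right {a b p q : M →₀ ℝ} (ha : 0 ≤ a) (hb : 0 ≤ b) (hp : 0 ≤ p)
    (hq : 0 ≤ q) (hpq : SameValue p q) (h : a + q = b + p) : SameValue a b := by
  filter_upwards [hpq, scaledSum_add ha hq, scaledSum_add hb hp,
    exists_scaledSum_eq_of (add_nonneg ha hq)] with t h₁ h₂ h₃ ⟨w, hw, _⟩
  refine PartialSum.add_right_cancel_of (c := scaledSum q t) (w := w) (h₂ ▸ hw) ?_
  rw [← h₁, ← h₃, ← h, hw]

/-- Selects a scale of the form `s / n` at which an eventual relation holds, so that its `n`-fold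
sum is a relation at the prescribed scale `s`. -/
theorem SameValue.exists_nat {a b : M →₀ ℝ} (h : SameValue a b) {p : ℝ → Prop}
    (hp : ∀ᶠ t in 𝓝[>] (0 : ℝ), p t) {s : ℝ} (hs : 0 < s) :
    ∃ n : ℕ, 0 < n ∧ scaledSum a (s / n) = scaledSum b (s / n) ∧ p (s / n) := by
  have ht : Tendsto (fun n : ℕ => s / n) atTop (𝓝[>] 0) := by
    refine tendsto_nhdsWithin_iff.2 ⟨tendsto_const_div_atTop_nhds_zero_nat s, ?_⟩
    filter_upwards [eventually_gt_atTop 0] with n hn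
    exact div_pos hs (Nat.cast_pos.2 hn)
  obtain ⟨n, hn, h₁, h₂⟩ :=
    ((eventually_gt_atTop 0).and (ht.eventually (Eventually.and h hp))).exists
  exact ⟨n, hn, h₁, h₂⟩

variable (M) in
/-- The cone of formal combinations that are positive as a consequence of the effect module
structure. -/
def positiveCone : PointedCone ℝ (M →₀ ℝ) where
  carrier := {v | ∃ c p q : M →₀ ℝ, 0 ≤ c ∧ 0 ≤ p ∧ 0 ≤ q ∧ v + q = c + p ∧ SameValue p q}
  zero_mem' := ⟨0, 0, 0, le_rfl, le_rfl, le_rfl, rfl, SameValue.refl 0⟩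
  add_mem' := by
    rintro v v' ⟨c, p, q, hc, hp, hq, h, hpq⟩ ⟨c', p', q', hc', hp', hq', h', hpq'⟩
    refine ⟨c + c', p + p', q + q', add_nonneg hc hc', add_nonneg hp hp', add_nonneg hq hq', ?_,
      hpq.add hp hq hp' hq' hpq'⟩
    rw [add_add_add_comm, h, h', add_add_add_comm]
  smul_mem' := by
    rintro ⟨r, hr⟩ v ⟨c, p, q, hc, hp, hq, h, hpq⟩
    refine ⟨r • c, r • p, r • q, smul_nonneg hr hc, smul_nonneg hr hp, smul_nonneg hr hq, ?_,
      hpq.smul hr⟩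
    change r • v + r • q = _
    rw [← smul_add, h, smul_add]

theorem mem_positiveCone {v : M →₀ ℝ} : v ∈ positiveCone M ↔
    ∃ c p q : M →₀ ℝ, 0 ≤ c ∧ 0 ≤ p ∧ 0 ≤ q ∧ v + q = c + p ∧ SameValue p q := Iff.rfl

theorem mem_positiveCone_of_nonneg {c : M →₀ ℝ} (hc : 0 ≤ c) : c ∈ positiveCone M :=
  ⟨c, 0, 0, hc, le_rfl, le_rfl, rfl, SameValue.refl 0⟩

/-- As `SameValue` is symmetric, `q - p` lies in the cone too, so functionals nonnegative on the
cone take equal values at `p` and `q`. -/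
theorem sub_mem_positiveCone {p q : M →₀ ℝ} (hp : 0 ≤ p) (hq : 0 ≤ q) (h : SameValue p q) :
    p - q ∈ positiveCone M :=
  ⟨0, p, q, le_rfl, hp, hq, by simp, h⟩

theorem sameValue_osum {x y z : M} (h : osum x y = some z) :
    SameValue (Finsupp.single x 1 + Finsupp.single y 1) (Finsupp.single z 1) := by
  filter_upwards [scaledSum_add (a := Finsupp.single x 1) (b := Finsupp.single y 1)
    (Finsupp.single_nonneg.2 zero_le_one) (Finsupp.single_nonneg.2 zero_le_one)] with t ht
  rw [ht, scaledSum_single, scaledSum_single, scaledSum_single, scale_osum _ h]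

theorem sameValue_smul (r : unitInterval) (x : M) :
    SameValue (Finsupp.single (r • x) 1) (Finsupp.single x (r : ℝ)) := by
  filter_upwards [eventually_nhdsGT_mul_le_one 1, self_mem_nhdsWithin] with t ht ht₀
  rw [mul_one] at ht
  rw [scaledSum_single, scaledSum_single, mul_one, scale_smul (le_of_lt ht₀) ht]

theorem single_one_sub_single_mem (x : M) :
    Finsupp.single (1 : M) (1 : ℝ) - Finsupp.single x 1 ∈ positiveCone M := by
  have h := (positiveCone M).add_mem
    (sub_mem_positiveCone (Finsupp.single_nonneg.2 zero_le_one)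
      (add_nonneg (Finsupp.single_nonneg.2 zero_le_one) (Finsupp.single_nonneg.2 zero_le_one))
      (sameValue_osum (osum_ocompl x)).symm)
    (mem_positiveCone_of_nonneg (c := Finsupp.single (ocompl x) 1)
      (Finsupp.single_nonneg.2 zero_le_one))
  rwa [sub_add_eq_sub_sub, sub_add_cancel] at h

/-- The order unit property of 1, which Riesz extension needs. -/
theorem exists_smul_single_one_add_mem (v : M →₀ ℝ) :
    ∃ c : ℝ, c • Finsupp.single (1 : M) 1 + v ∈ positiveCone M := by
  induction v using Finsupp.induction_linear with
  | zero => exact ⟨0, by simp [(positiveCone M).zero_mem]⟩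
  | add v w hv hw =>
    obtain ⟨c, hc⟩ := hv
    obtain ⟨d, hd⟩ := hw
    refine ⟨c + d, ?_⟩
    rw [_root_.add_smul, add_add_add_comm]
    exact (positiveCone M).add_mem hc hd
  | single x a =>
    obtain ha | ha := le_total 0 a
    · refine ⟨0, ?_⟩
      rw [_root_.zero_smul, zero_add]
      exact mem_positiveCone_of_nonneg (Finsupp.single_nonneg.2 ha)
    · refine ⟨-a, ?_⟩
      convert (positiveCone M).smul_mem (neg_nonneg.2 ha) (single_one_sub_single_mem x) using 1
      rw [smul_sub, sub_eq_add_neg, neg_smul a (Finsupp.single x 1), neg_neg,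
        Finsupp.smul_single_one x a]

/-- The state given by a normalised linear functional that is nonnegative on the positive cone. -/
noncomputable def stateOfPositive (g : (M →₀ ℝ) →ₗ[ℝ] ℝ) (h₁ : g (Finsupp.single 1 1) = 1)
    (hg : ∀ v ∈ positiveCone M, 0 ≤ g v) : EModState M where
  toFun x := ⟨g (Finsupp.single x 1),
    hg _ (mem_positiveCone_of_nonneg (Finsupp.single_nonneg.2 zero_le_one)), by
      have h := hg _ (single_one_sub_single_mem x)
      rw [map_sub, h₁] at h
      linarith⟩
  map_one := Subtype.ext h₁
  map_smul r x := by
    refine Subtype.ext ?_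
    change g (Finsupp.single (r • x) 1) = r * g (Finsupp.single x 1)
    have hr : (0 : M →₀ ℝ) ≤ Finsupp.single x (r : ℝ) := Finsupp.single_nonneg.2 r.2.1
    have h := hg _ (sub_mem_positiveCone (Finsupp.single_nonneg.2 zero_le_one) hr
      (sameValue_smul r x))
    have h' := hg _ (sub_mem_positiveCone hr (Finsupp.single_nonneg.2 zero_le_one)
      (sameValue_smul r x).symm)
    rw [map_sub, ← Finsupp.smul_single_one x (r : ℝ), g.map_smul, smul_eq_mul] at h h'
    linarith
  map_osum x y z h := by
    rw [EModState.osum_iff]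
    change g (Finsupp.single x 1) + g (Finsupp.single y 1) = g (Finsupp.single z 1)
    have hxy : (0 : M →₀ ℝ) ≤ Finsupp.single x 1 + Finsupp.single y 1 :=
      add_nonneg (Finsupp.single_nonneg.2 zero_le_one) (Finsupp.single_nonneg.2 zero_le_one)
    have h₂ := hg _ (sub_mem_positiveCone hxy (Finsupp.single_nonneg.2 zero_le_one)
      (sameValue_osum h))
    have h₃ := hg _ (sub_mem_positiveCone (Finsupp.single_nonneg.2 zero_le_one) hxy
      (sameValue_osum h).symm)
    rw [map_sub, map_add] at h₂ h₃
    linarith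

end EffectModule

/-! ### Extension of positive functionals. -/

/-- A vector outside a pointed cone with order unit `u` is nonpositive under some normalised
functional that is nonnegative on the cone. -/
theorem PointedCone.exists_nonneg_functional {E : Type*} [AddCommGroup E] [Module ℝ E]
    (Q : PointedCone ℝ E) {u v : E} (hu : u ∈ Q) (hunit : ∀ x, ∃ c : ℝ, c • u + x ∈ Q)
    (hv : v ∉ Q) : ∃ g : E →ₗ[ℝ] ℝ, g u = 1 ∧ (∀ x ∈ Q, 0 ≤ g x) ∧ g v ≤ 0 := by
  -- If `-u` were in `Q`, the order unit property would put `v` in `Q`.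
  have hneg : -u ∉ Q := fun h => by
    obtain ⟨c, hc⟩ := hunit v
    obtain hc₀ | hc₀ := le_total 0 c
    · have := Q.add_mem hc (Q.smul_mem hc₀ h)
      rw [smul_neg, add_neg_cancel_comm] at this
      exact hv this
    · have := Q.add_mem hc (Q.smul_mem (neg_nonneg.2 hc₀) hu)
      rw [neg_smul, add_neg_cancel_comm] at this
      exact hv this
  have hu₀ : u ≠ 0 := by
    rintro rfl
    exact hneg (by rwa [neg_zero])
  -- Nonnegativity on the cone enlarged by `-v` is what forces `g v ≤ 0`.
  let Q' : PointedCone ℝ E := Q ⊔ Submodule.span _ {-v}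
  obtain ⟨g, hg, hgQ⟩ := riesz_extension Q' (LinearPMap.mkSpanSingleton u (1 : ℝ) hu₀) (by
    rintro ⟨x, hx⟩ hxQ
    obtain ⟨c, rfl⟩ := Submodule.mem_span_singleton.1 hx
    rw [LinearPMap.mkSpanSingleton'_apply, RingHom.id_apply, smul_eq_mul, mul_one]
    -- Suppose `c • u = p - t • v` with `c < 0`. If `t = 0`, then `-u ∈ Q`; otherwise `v = t⁻¹ • (p
    -- + (-c) • u) ∈ Q`.
    by_contra! hc
    obtain ⟨p, hp, w, hw, h⟩ := Submodule.mem_sup.1 hxQ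
    obtain ⟨⟨t, ht⟩, rfl⟩ := Submodule.mem_span_singleton.1 hw
    change p + t • -v = c • u at h
    obtain rfl | ht := ht.eq_or_lt
    · rw [zero_smul, add_zero] at h
      refine hneg ?_
      have := Q.smul_mem (inv_nonneg.2 (neg_nonneg.2 hc.le)) (h ▸ hp)
      rwa [smul_smul, inv_neg, neg_mul, inv_mul_cancel₀ hc.ne, neg_one_smul] at this
    · refine hv ?_
      have hpu : t • v = p + (-c) • u := by
        rw [neg_smul, ← h, smul_neg]; abel
      have := Q.smul_mem (inv_nonneg.2 ht.le) (Q.add_mem hp (Q.smul_mem (neg_nonneg.2 hc.le) hu))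
      rwa [← hpu, smul_smul, inv_mul_cancel₀ ht.ne', one_smul] at this) (fun y => by
    obtain ⟨c, hc⟩ := hunit y
    exact ⟨⟨c • u, Submodule.smul_mem _ _ (Submodule.mem_span_singleton_self u)⟩,
      Submodule.mem_sup_left hc⟩)
  refine ⟨g, ?_, fun x hx => hgQ x (Submodule.mem_sup_left hx), ?_⟩
  · have := hg ⟨u, Submodule.mem_span_singleton_self u⟩
    rw [this]
    exact LinearPMap.mkSpanSingleton'_apply_self _ _ _ _
  · have := hgQ (-v) (Submodule.mem_sup_right (Submodule.mem_span_singleton_self _))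
    rw [map_neg] at this
    linarith

/-! ### States determine positivity and the distance. -/

namespace EffectModule

variable {M : Type u} [EffectModule M]

/-- Otherwise a normalised functional nonnegative on the cone and nonpositive at `v` restricts to a
state contradicting `h`. This gives only `≤ 0`, whence the strict hypothesis. -/
theorem mem_positiveCone_of_forall_state_pos {v : M →₀ ℝ}
    (h : ∀ k : EModState M, 0 < Finsupp.linearCombination ℝ (fun x => (k x : ℝ)) v) :
    v ∈ positiveCone M := by
  by_contra hv
  obtain ⟨g, h₁, hg, hgv⟩ := (positiveCone M).exists_nonneg_functional
    (mem_positiveCone_of_nonneg (c := Finsupp.single (1 : M) (1 : ℝ))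
      (Finsupp.single_nonneg.2 zero_le_one))
    exists_smul_single_one_add_mem hv
  refine (h (stateOfPositive g h₁ hg)).not_ge ?_
  refine le_of_eq_of_le ?_ hgv
  rw [Finsupp.linearCombination_apply]
  conv_rhs => rw [← Finsupp.sum_single v, Finsupp.sum, map_sum]
  refine Finset.sum_congr rfl fun x _ => ?_
  rw [← Finsupp.smul_single_one x (v x), g.map_smul]
  rfl

/-- A formal combination between `0` and `1` is represented by an element. -/
theorem exists_forall_state_eq {v : M →₀ ℝ} (h₀ : v ∈ positiveCone M)
    (h₁ : Finsupp.single 1 1 - v ∈ positiveCone M) :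
    ∃ y : M, ∀ k : EModState M,
      (k y : ℝ) = Finsupp.linearCombination ℝ (fun x => (k x : ℝ)) v := by
  obtain ⟨c, p, q, hc, hp, hq, h, hpq⟩ := mem_positiveCone.1 h₀
  obtain ⟨c', p', q', hc', hp', hq', h', hpq'⟩ := mem_positiveCone.1 h₁
  -- Adding the two cone relations gives `1 + (q + q') = (c + c') + (p + p')`, from which the
  -- equivalent parts cancel.
  have hcc : SameValue (Finsupp.single (1 : M) (1 : ℝ)) (c + c') := by
    refine SameValue.of_add_right (Finsupp.single_nonneg.2 zero_le_one) (add_nonneg hc hc')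
      (add_nonneg hp hp') (add_nonneg hq hq') (hpq.add hp hq hp' hq' hpq') ?_
    rw [add_add_add_comm, ← h, ← h']
    abel
  obtain ⟨n, hn, hs, hadd, ⟨z, hz, hkz⟩, hpqn, ⟨w, hw, hkw⟩, w', hw', hkw'⟩ := hcc.exists_nat
    ((scaledSum_add hc hc').and ((exists_scaledSum_eq_of hc).and
      (Filter.Eventually.and hpq ((exists_scaledSum_eq_of hp).and (exists_scaledSum_eq_of hq)))))
    one_pos
  have hn' : (n : ℝ) ≠ 0 := Nat.cast_ne_zero.2 hn.ne'
  have hn1 : (n : ℝ) * (1 / n) = 1 := mul_one_div_cancel hn'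
  rw [hadd, scaledSum_single, mul_one] at hs
  -- The `n`-fold sum of the relation at scale `1 / n` equals 1, so its part `n • z` is defined;
  -- this is the required element.
  have hs' := congrArg (n • ·) hs
  simp only [smul_add] at hs'
  rw [nsmul_scale (by positivity) n hn1.le, hn1, scale_one] at hs'
  obtain ⟨y, -, hy, -, -⟩ := PartialSum.add_eq_of.1 hs'.symm
  rw [hz] at hy
  refine ⟨y, fun k => ?_⟩
  have hv := congrArg (Finsupp.linearCombination ℝ (fun x => (k x : ℝ))) h
  rw [map_add, map_add] at hv
  have hpqk : w = w' := PartialSum.of_injective (by rw [← hw, ← hw', hpqn])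
  have e₁ := hkw k
  have e₂ := hkw' k
  rw [hpqk, e₂] at e₁
  have e₃ := mul_left_cancel₀ (one_div_ne_zero hn') e₁
  rw [coe_state_nsmul k hy, hkz k, ← mul_assoc, hn1, one_mul]
  linarith

/-- The two halves, added to the halves of the orthosupplements of `y` and `r • 1`, give `½ 1 ⊕ ½ 1
= 1`. -/
theorem osum_half_some (y : M) (r : unitInterval) :
    ∃ w, osum (half • y) ((half * r) • (1 : M)) = some w := by
  have hh : ((half : unitInterval) : ℝ) = 1 / 2 := rfl
  have h₁ : osum (half • (1 : M)) (half • 1) = some 1 := by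
    have := add_smul half half 1 (1 : M) (by rw [hh]; norm_num)
    rwa [one_smul] at this
  have h₂ := smul_osum half _ _ _ (osum_ocompl y)
  have h₃ := smul_osum half _ _ _ (osum_ocompl (r • (1 : M)))
  have h : (PartialSum.of (half • y) + PartialSum.of (half • r • (1 : M))) +
      (PartialSum.of (half • ocompl y) + PartialSum.of (half • ocompl (r • (1 : M)))) =
      PartialSum.of 1 := by
    rw [add_add_add_comm, PartialSum.of_add_of.2 h₂, PartialSum.of_add_of.2 h₃,
      PartialSum.of_add_of.2 h₁]
  obtain ⟨w, -, hw, -, -⟩ := PartialSum.add_eq_of.1 h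
  exact ⟨w, by rw [mul_smul]; exact PartialSum.of_add_of.1 hw⟩

/-- The cone relation is cleared of its equivalent parts, taken at scale `(1 / 2) / n` and summed
`n` times. The factor one half keeps the sum with `r` defined. -/
theorem halfLe_of_mem_positiveCone {x y : M} {r : unitInterval}
    (h : Finsupp.single y 1 + Finsupp.single 1 (r : ℝ) - Finsupp.single x 1 ∈ positiveCone M) :
    HalfLe x y r := by
  obtain ⟨w, hw⟩ := osum_half_some y r
  refine ⟨w, hw, ?_⟩
  obtain ⟨c, p, q, hc, hp, hq, h, hpq⟩ := mem_positiveCone.1 h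
  have hx : (0 : M →₀ ℝ) ≤ Finsupp.single x 1 := Finsupp.single_nonneg.2 zero_le_one
  have hy : (0 : M →₀ ℝ) ≤ Finsupp.single y 1 := Finsupp.single_nonneg.2 zero_le_one
  have hr : (0 : M →₀ ℝ) ≤ Finsupp.single 1 (r : ℝ) := Finsupp.single_nonneg.2 r.2.1
  have hs : SameValue (Finsupp.single y 1 + Finsupp.single 1 (r : ℝ))
      (Finsupp.single x 1 + c) := by
    refine SameValue.of_add_right (add_nonneg hy hr) (add_nonneg hx hc) hp hq hpq ?_
    rw [add_assoc _ c, ← h]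
    abel
  obtain ⟨n, hn, hs, h₁, h₂⟩ := hs.exists_nat
    ((scaledSum_add hy hr).and (scaledSum_add hx hc)) (s := 1 / 2) (by norm_num)
  have hn' : (n : ℝ) ≠ 0 := Nat.cast_ne_zero.2 hn.ne'
  have hn1 : (n : ℝ) * (1 / 2 / n) = 1 / 2 := mul_div_cancel₀ _ hn'
  have hr₀ := r.2.1
  have hn2 : (n : ℝ) * (1 / 2 / n * r) = (half * r : unitInterval) := by
    rw [← mul_assoc, hn1]; rfl
  rw [h₁, h₂] at hs
  simp only [scaledSum_single, mul_one] at hs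
  have hs' := congrArg (n • ·) hs
  simp only [smul_add] at hs'
  rw [nsmul_scale (by positivity) n (by rw [hn1]; norm_num),
    nsmul_scale (by positivity) n (by rw [hn2]; exact (half * r).2.2),
    nsmul_scale (by positivity) n (by rw [hn1]; norm_num), hn2, hn1,
    show (1 / 2 : ℝ) = (half : unitInterval) from rfl, scale_coe, scale_coe, scale_coe,
    PartialSum.of_add_of.2 hw] at hs'
  obtain ⟨a, b, ha, -, hab⟩ := PartialSum.add_eq_of.1 hs'.symm
  rw [← PartialSum.of_injective ha] at hab
  exact ⟨b, hab⟩

theorem halfLe_of_forall_state {x y : M} {r : unitInterval}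
    (h : ∀ k : EModState M, (k x : ℝ) < k y + r) : HalfLe x y r := by
  refine halfLe_of_mem_positiveCone (mem_positiveCone_of_forall_state_pos fun k => ?_)
  simp only [map_sub, map_add, Finsupp.linearCombination_single, smul_eq_mul, one_mul,
    coe_state_one, mul_one]
  linarith [h k]

theorem HalfLe.state_le {x y : M} {r : unitInterval} (h : HalfLe x y r) (k : EModState M) :
    (k x : ℝ) ≤ k y + r := by
  obtain ⟨w, hw, hle⟩ := h
  have h₁ := coe_state_osum k hw
  have h₂ := coe_state_le k hle
  rw [coe_state_smul, coe_state_smul, coe_state_one, Set.Icc.coe_mul] at h₁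
  rw [coe_state_smul] at h₂
  have hh : ((half : unitInterval) : ℝ) = 1 / 2 := rfl
  rw [hh] at h₁ h₂
  linarith

/-- Keeps the infima in `emDist` away from the empty set, whose `sInf` is 0 by convention. -/
theorem halfLe_one (x y : M) : HalfLe x y 1 := by
  refine halfLe_of_mem_positiveCone ?_
  rw [add_sub_assoc]
  exact (positiveCone M).add_mem
    (mem_positiveCone_of_nonneg (Finsupp.single_nonneg.2 zero_le_one))
    (single_one_sub_single_mem x)

/-- The infimum of the `r ∈ (0,1]` satisfying a predicate that holds at `1`. -/
theorem sInf_image_le_iff {p : unitInterval → Prop} (h₁ : p 1) {ε : ℝ} :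
    sInf ((fun r : unitInterval => (r : ℝ)) '' {r | 0 < r ∧ p r}) ≤ ε ↔
      ∀ δ > ε, ∃ r : unitInterval, 0 < r ∧ p r ∧ (r : ℝ) < δ := by
  have hne : ((fun r : unitInterval => (r : ℝ)) '' {r | 0 < r ∧ p r}).Nonempty :=
    ⟨1, 1, ⟨zero_lt_one, h₁⟩, rfl⟩
  have hbdd : BddBelow ((fun r : unitInterval => (r : ℝ)) '' {r | 0 < r ∧ p r}) :=
    ⟨0, by rintro _ ⟨r, -, rfl⟩; exact r.2.1⟩
  constructor
  · intro h δ hδ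
    obtain ⟨_, ⟨r, ⟨hr, hpr⟩, rfl⟩, hrδ⟩ := exists_lt_of_csInf_lt hne (h.trans_lt hδ)
    exact ⟨r, hr, hpr, hrδ⟩
  · refine fun h => le_of_forall_gt_imp_ge_of_dense fun δ hδ => ?_
    obtain ⟨r, hr, hpr, hrδ⟩ := h δ hδ
    exact (csInf_le hbdd ⟨r, ⟨hr, hpr⟩, rfl⟩).trans hrδ.le

theorem emDist_nonneg (x y : M) : 0 ≤ emDist x y :=
  le_max_of_le_left (Real.sInf_nonneg (by rintro _ ⟨r, -, rfl⟩; exact r.2.1))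

/-- The distance is the supremum distance for any family of real functions that determines
the relations `HalfLe`. -/
theorem emDist_le_iff_of_family {ι : Type*} (e : ι → M → ℝ)
    (h₁ : ∀ {x y : M} {r : unitInterval}, HalfLe x y r → ∀ i, e i x ≤ e i y + r)
    (h₂ : ∀ {x y : M} {r : unitInterval}, (∀ i, e i x < e i y + r) → HalfLe x y r)
    {x y : M} {ε : ℝ} (hε : 0 ≤ ε) : emDist x y ≤ ε ↔ ∀ i, |e i x - e i y| ≤ ε := by
  have key (x y : M) : sInf ((fun r : unitInterval => (r : ℝ)) '' {r | 0 < r ∧ HalfLe x y r}) ≤ ε ↔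
      ∀ i, e i x ≤ e i y + ε := by
    rw [sInf_image_le_iff (halfLe_one x y)]
    constructor
    · refine fun h i => le_of_forall_pos_le_add fun δ hδ => ?_
      obtain ⟨r, -, hr, hrδ⟩ := h (ε + δ) (by linarith)
      linarith [h₁ hr i]
    · intro h δ hδ
      obtain hδ₁ | hδ₁ := lt_or_ge 1 δ
      · exact ⟨1, zero_lt_one, halfLe_one x y, hδ₁⟩
      · have hm : (0 : ℝ) < (ε + δ) / 2 := by linarith
        refine ⟨⟨(ε + δ) / 2, hm.le, by linarith⟩, hm, h₂ fun i => ?_,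
          by change (ε + δ) / 2 < δ; linarith⟩
        change e i x < e i y + (ε + δ) / 2
        linarith [h i]
  rw [emDist, max_le_iff, key, key, ← forall_and]
  refine forall_congr' fun k => ?_
  rw [abs_le]
  constructor <;> rintro ⟨h, h'⟩ <;> constructor <;> linarith

/-- The distance is the supremum distance on states. -/
theorem emDist_le_iff {x y : M} {ε : ℝ} (hε : 0 ≤ ε) :
    emDist x y ≤ ε ↔ ∀ k : EModState M, |(k x : ℝ) - k y| ≤ ε :=
  emDist_le_iff_of_family (fun (k : EModState M) x => (k x : ℝ)) (fun h => h.state_le)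
    halfLe_of_forall_state hε

theorem IsArchimedean.le_of_forall_state (hM : IsArchimedean M) {x y : M}
    (h : ∀ k : EModState M, (k x : ℝ) ≤ k y) : Le x y :=
  hM x y fun r hr => halfLe_of_forall_state fun k => by
    have : (0 : ℝ) < r := hr
    linarith [h k]

end EffectModule

/-- Continuity for the product topology makes `L` depend on finitely many coordinates. -/
theorem ContinuousLinearMap.exists_eq_linearCombination {ι : Type*} (L : (ι → ℝ) →L[ℝ] ℝ) :
    ∃ v : ι →₀ ℝ, ∀ φ, L φ = Finsupp.linearCombination ℝ φ v := by
  classical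
  have hopen : IsOpen (L ⁻¹' Metric.ball 0 1) := Metric.isOpen_ball.preimage L.continuous
  obtain ⟨I, u, hu, hI⟩ := isOpen_pi_iff.1 hopen 0 (by simp)
  have hzero (φ : ι → ℝ) (hφ : ∀ i ∈ I, φ i = 0) : L φ = 0 := by
    by_contra h
    -- The rescaled vector vanishes on `I`, hence lies in the basic neighbourhood, yet `L` takes the
    -- value 1 there, outside the unit ball.
    have hmem : (L φ)⁻¹ • φ ∈ (I : Set ι).pi u := fun i hi => by
      rw [Pi.smul_apply, hφ i hi, smul_zero]
      exact (hu i hi).2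
    have h₁ := hI hmem
    simp [h] at h₁
  refine ⟨∑ i ∈ I, Finsupp.single i (L (Pi.single i 1)), fun φ => ?_⟩
  have h := hzero (φ - ∑ i ∈ I, φ i • Pi.single i (1 : ℝ)) fun j hj => by
    simp [Finset.sum_apply, Pi.single_apply, hj]
  rw [map_sub, sub_eq_zero] at h
  rw [h, map_sum, map_sum]
  refine Finset.sum_congr rfl fun i _ => ?_
  rw [map_smul, Finsupp.linearCombination_single, smul_eq_mul, smul_eq_mul, mul_comm]

/-! ### Affine continuous functions form a Banach effect module. -/

namespace AffineCont
open EffectModule Filter Topology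

variable {X : Type u} [TopologicalSpace X] [Convexity.ConvexSpace ℝ X]

/-- Evaluation at a point, as a state. -/
def evalState (x : X) : EModState (AffineCont X) where
  toFun p := p x
  map_one := rfl
  map_smul _ _ := rfl
  map_osum _ _ _ h := EModState.osum_iff.2 (osum_eq_some.1 h x)

theorem le_iff {p q : AffineCont X} : Le p q ↔ ∀ x, (p x : ℝ) ≤ q x := by
  refine ⟨fun h x => coe_state_le (evalState x) h, fun h => ?_⟩
  have h' (x : X) : (p x : ℝ) + compl q x ≤ 1 := by
    change (p x : ℝ) + (1 - q x) ≤ 1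
    linarith [h x]
  refine ⟨compl (add p (compl q) h'), osum_eq_some.2 fun x => ?_⟩
  change (p x : ℝ) + (1 - (p x + (1 - q x))) = q x
  ring

theorem halfLe_iff {p q : AffineCont X} {r : unitInterval} :
    HalfLe p q r ↔ ∀ x, (p x : ℝ) ≤ q x + r := by
  refine ⟨fun h x => h.state_le (evalState x), fun h => ?_⟩
  obtain ⟨w, hw⟩ := osum_half_some q r
  refine ⟨w, hw, le_iff.2 fun x => ?_⟩
  have h₁ : (half : ℝ) * q x + half * r * 1 = w x := osum_eq_some.1 hw x
  change (half : ℝ) * p x ≤ w x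
  have hh : ((half : unitInterval) : ℝ) = 1 / 2 := rfl
  rw [hh] at h₁ ⊢
  linarith [h x]

/-- Point evaluations already determine `HalfLe`, so other states of `AffineCont X` need not be
known. -/
theorem emDist_le_iff {p q : AffineCont X} {ε : ℝ} (hε : 0 ≤ ε) :
    emDist p q ≤ ε ↔ ∀ x, |(p x : ℝ) - q x| ≤ ε :=
  emDist_le_iff_of_family (fun x (p : AffineCont X) => (p x : ℝ)) halfLe_iff.1
    (fun h => halfLe_iff.2 fun x => (h x).le) hε

theorem isArchimedean : IsArchimedean (AffineCont X) := by
  refine fun p q h => le_iff.2 fun x => le_of_forall_pos_le_add fun δ hδ => ?_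
  obtain hδ₁ | hδ₁ := le_total 1 δ
  · linarith [(p x).2.2, (q x).2.1]
  · exact halfLe_iff.1 (h ⟨δ, hδ.le, hδ₁⟩ hδ) x

/-- Cauchy sequences converge uniformly, and uniform limits stay continuous and affine. -/
theorem isMetricComplete : IsMetricComplete (AffineCont X) := by
  intro a ha
  have hcau (ε : ℝ) (hε : 0 < ε) : ∃ N, ∀ m ≥ N, ∀ n ≥ N, ∀ x, |(a m x : ℝ) - a n x| ≤ ε := by
    obtain ⟨N, hN⟩ := ha ε hε
    exact ⟨N, fun m hm n hn => (emDist_le_iff hε.le).1 (hN m hm n hn).le⟩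
  have hlim (x : X) : ∃ y : unitInterval, Tendsto (fun n => a n x) atTop (𝓝 y) := by
    refine cauchySeq_tendsto_of_complete (Metric.cauchySeq_iff.2 fun ε hε => ?_)
    obtain ⟨N, hN⟩ := hcau (ε / 2) (half_pos hε)
    refine ⟨N, fun m hm n hn => ?_⟩
    rw [Subtype.dist_eq, Real.dist_eq]
    linarith [hN m hm n hn x]
  choose F hF using hlim
  have hF' (x : X) : Tendsto (fun n => (a n x : ℝ)) atTop (𝓝 (F x)) :=
    (continuous_subtype_val.tendsto _).comp (hF x)
  have hunif (ε : ℝ) (hε : 0 < ε) : ∃ N, ∀ n ≥ N, ∀ x, |(a n x : ℝ) - F x| ≤ ε := by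
    obtain ⟨N, hN⟩ := hcau ε hε
    refine ⟨N, fun n hn x => ?_⟩
    refine le_of_tendsto ((tendsto_const_nhds.sub (hF' x)).abs) ?_
    filter_upwards [eventually_ge_atTop N] with m hm
    exact hN n hn m hm x
  have hcont : Continuous F := by
    have h : TendstoUniformly (fun n => (a n).toFun) F atTop := by
      refine Metric.tendstoUniformly_iff.2 fun ε hε => ?_
      obtain ⟨N, hN⟩ := hunif (ε / 2) (half_pos hε)
      filter_upwards [eventually_ge_atTop N] with n hn x
      rw [dist_comm, Subtype.dist_eq, Real.dist_eq]
      linarith [hN n hn x]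
    exact h.continuous (Frequently.of_forall fun n => (a n).continuous_toFun)
  refine ⟨⟨F, hcont, isAffineMap_real_iff.2 fun s => ?_⟩, fun ε hε => ?_⟩
  · refine tendsto_nhds_unique (hF' _) ?_
    simp only [fun n => isAffineMap_real_iff.1 (a n).affine_toFun s]
    exact tendsto_finsetSum _ fun x _ => (hF' x).const_mul _
  · obtain ⟨N, hN⟩ := hunif (ε / 2) (half_pos hε)
    refine ⟨N, fun n hn => ?_⟩
    exact ((emDist_le_iff (half_pos hε).le).2 (hN n hn)).trans_lt (half_lt_self hε)

theorem isBanach : IsBanach (AffineCont X) := ⟨isArchimedean, isMetricComplete⟩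

theorem apply_convexCombPair (p : AffineCont X) {a b : ℝ} (ha : 0 ≤ a) (hb : 0 ≤ b)
    (hab : a + b = 1) (x y : X) :
    (p (Convexity.convexCombPair a b ha hb hab x y) : ℝ) = a * p x + b * p y := by
  rw [p.affine_toFun.map_convexCombPair ha hb hab x y, Convexity.convexCombPair_eq_sum]
  rfl

end AffineCont

/-! ### Density, isometry and surjectivity of evaluation. -/

namespace EffectModule

variable {M : Type u} [EffectModule M]

/-- Affine continuous functions on the state space are uniformly approximated, strictly from
above, by formal combinations of elements of the effect module. -/
theorem exists_linearCombination_between (f : AffineCont (EModState M)) {δ : ℝ} (hδ : 0 < δ) :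
    ∃ v : M →₀ ℝ, ∀ k : EModState M,
      (f k : ℝ) < Finsupp.linearCombination ℝ (fun x => (k x : ℝ)) v ∧
      Finsupp.linearCombination ℝ (fun x => (k x : ℝ)) v < f k + δ := by
  obtain hempty | ⟨⟨k₀⟩⟩ := isEmpty_or_nonempty (EModState M)
  · exact ⟨0, fun k => hempty.elim k⟩
  -- The graphs of `f` and `f + δ` are compact and convex, and disjoint because a state is
  -- determined by its values.
  let graph (s : ℝ) (k : EModState M) : (M → ℝ) × ℝ := (fun x => (k x : ℝ), f k + s)
  have hcomp (s : ℝ) : IsCompact (Set.range (graph s)) := by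
    refine isCompact_range (Continuous.prodMk (continuous_pi fun x => ?_) ?_)
    · exact continuous_subtype_val.comp ((evalHom M x).continuous_toFun)
    · exact (continuous_subtype_val.comp f.continuous_toFun).add continuous_const
  have hconv (s : ℝ) : Convex ℝ (Set.range (graph s)) := by
    rintro _ ⟨k, rfl⟩ _ ⟨l, rfl⟩ a b ha hb hab
    refine ⟨Convexity.convexCombPair a b ha hb hab k l, Prod.ext (funext fun x => ?_) ?_⟩
    · exact (evalHom M x).apply_convexCombPair ha hb hab k l
    · change (f _ : ℝ) + s = a * (f k + s) + b * (f l + s)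
      rw [f.apply_convexCombPair]
      linear_combination (-s) * hab
  have hdisj : Disjoint (Set.range (graph 0)) (Set.range (graph δ)) := by
    refine Set.disjoint_left.2 ?_
    rintro _ ⟨k, rfl⟩ ⟨l, hl⟩
    obtain rfl : l = k := EModHom.ext' fun x => Subtype.ext (congrFun (congrArg Prod.fst hl) x)
    have h₂ : (f l : ℝ) + δ = f l + 0 := congrArg Prod.snd hl
    linarith
  obtain ⟨L, a, b, hL₀, hab, hLδ⟩ := geometric_hahn_banach_compact_closed (hconv 0) (hcomp 0)
    (hconv δ) (hcomp δ).isClosed hdisj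
  obtain ⟨v, hv⟩ := (L.comp (ContinuousLinearMap.inl ℝ (M → ℝ) ℝ)).exists_eq_linearCombination
  set c := L (0, 1) with hc
  have hgraph (s : ℝ) (k : EModState M) :
      L (graph s k) = Finsupp.linearCombination ℝ (fun x => (k x : ℝ)) v + c * (f k + s) := by
    have h : graph s k = (fun x => (k x : ℝ), 0) + ((f k : ℝ) + s) • ((0, 1) : (M → ℝ) × ℝ) := by
      ext <;> simp [graph]
    rw [h, map_add, map_smul, ← hv, smul_eq_mul, mul_comm]
    rfl
  have h₀ (k : EModState M) := hgraph 0 k ▸ hL₀ _ ⟨k, rfl⟩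
  have h₁ (k : EModState M) := hgraph δ k ▸ hLδ _ ⟨k, rfl⟩
  -- Over a single state `k₀` the two graphs differ by the vertical shift `δ`, so separation forces
  -- a positive vertical coefficient.
  have hcpos : 0 < c := by
    have := h₀ k₀
    have := h₁ k₀
    refine pos_of_mul_pos_left (b := δ) ?_ hδ.le
    linarith
  -- This is the height of the hyperplane `L = a` over `k`; the constant `a` is `a` times the unit,
  -- since states are normalised.
  refine ⟨c⁻¹ • (Finsupp.single 1 a - v), fun k => ?_⟩
  simp only [map_smul, map_sub, Finsupp.linearCombination_single, smul_eq_mul, coe_state_one,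
    mul_one]
  rw [inv_mul_eq_div, lt_div_iff₀ hcpos, div_lt_iff₀ hcpos]
  constructor <;> linarith [h₀ k, h₁ k]

theorem evalHom_hasDenseImage : (evalHom M).HasDenseImage := by
  intro f ε hε
  have hδ : 0 < ε / 2 := half_pos hε
  set δ := ε / 2
  have hδ₁ : (0 : ℝ) < 1 + δ := by linarith
  obtain ⟨v, hv⟩ := exists_linearCombination_between f hδ
  -- As `f < v < f + δ ≤ 1 + δ` on states, division by `1 + δ` moves `v` strictly between 0 and 1,
  -- while staying within `δ` of `f`.
  have hlin (k : EModState M) :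
      Finsupp.linearCombination ℝ (fun x => (k x : ℝ)) ((1 + δ)⁻¹ • v) =
        Finsupp.linearCombination ℝ (fun x => (k x : ℝ)) v / (1 + δ) := by
    rw [map_smul, smul_eq_mul, inv_mul_eq_div]
  obtain ⟨y, hy⟩ := exists_forall_state_eq (v := (1 + δ)⁻¹ • v)
    (mem_positiveCone_of_forall_state_pos fun k => by
      rw [hlin]
      exact div_pos ((f k).2.1.trans_lt (hv k).1) hδ₁)
    (mem_positiveCone_of_forall_state_pos fun k => by
      rw [map_sub, hlin, Finsupp.linearCombination_single, smul_eq_mul, one_mul, coe_state_one,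
        sub_pos, div_lt_one hδ₁]
      linarith [(hv k).2, (f k).2.2])
  refine ⟨y, ((AffineCont.emDist_le_iff hδ.le).2 fun k => ?_).trans_lt (half_lt_self hε)⟩
  change |(k y : ℝ) - f k| ≤ δ
  rw [hy, hlin, abs_le]
  have hfk₀ := (f k).2.1
  have hfk₁ := (f k).2.2
  constructor
  · rw [le_sub_iff_add_le, le_div_iff₀ hδ₁]
    nlinarith [(hv k).1]
  · rw [sub_le_iff_le_add, div_le_iff₀ hδ₁]
    nlinarith [(hv k).2]

/-- Both distances are the supremum over the same states. -/
theorem emDist_evalHom (x y : M) : emDist (evalHom M x) (evalHom M y) = emDist x y := by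
  have key {ε : ℝ} (hε : 0 ≤ ε) : emDist (evalHom M x) (evalHom M y) ≤ ε ↔ emDist x y ≤ ε := by
    rw [AffineCont.emDist_le_iff hε, emDist_le_iff hε]
    rfl
  exact le_antisymm ((key (emDist_nonneg _ _)).2 le_rfl) ((key (emDist_nonneg _ _)).1 le_rfl)

theorem IsArchimedean.evalHom_isEmbedding (hM : IsArchimedean M) : (evalHom M).IsEmbedding where
  injective x y h := by
    have h' (k : EModState M) : k x = k y := congrArg (fun p : AffineCont _ => p k) h
    exact (hM.le_of_forall_state fun k => by rw [h' k]).antisymm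
      (hM.le_of_forall_state fun k => by rw [h' k])
  reflects_orth x y h := by
    obtain ⟨z, hz⟩ := Option.isSome_iff_exists.1 h
    refine orth_iff_le_ocompl.2 (hM.le_of_forall_state fun k => ?_)
    have h₁ : (k x : ℝ) + k y = z k := AffineCont.osum_eq_some.1 hz k
    rw [coe_state_ocompl]
    linarith [(z k).2.2]
  isometric := emDist_evalHom

theorem map_le {N : Type v} [EffectModule N] (g : EModHom M N) {x y : M} (h : Le x y) :
    Le (g x) (g y) := by
  obtain ⟨z, hz⟩ := h
  exact ⟨g z, g.map_osum _ _ _ hz⟩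

theorem isBanach_of_isIso_evalHom (h : (evalHom M).IsIso) : IsBanach M := by
  obtain ⟨g, hg₁, hg₂⟩ := h
  constructor
  · intro x y hxy
    rw [← hg₁ x, ← hg₁ y]
    refine map_le g (AffineCont.le_iff.2 fun k => le_of_forall_pos_le_add fun δ hδ => ?_)
    obtain hδ₁ | hδ₁ := le_total 1 δ
    · linarith [(evalHom M x k).2.2, (evalHom M y k).2.1]
    · exact (hxy ⟨δ, hδ.le, hδ₁⟩ hδ).state_le k
  · intro a ha
    obtain ⟨f, hf⟩ := AffineCont.isMetricComplete (fun n => evalHom M (a n)) (by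
      simpa only [emDist_evalHom] using ha)
    refine ⟨g f, fun ε hε => ?_⟩
    obtain ⟨N, hN⟩ := hf ε hε
    refine ⟨N, fun n hn => ?_⟩
    rw [← emDist_evalHom, hg₂]
    exact hN n hn

/-- Approximants of `f` from the dense image form a Cauchy sequence in `M` by isometry, and
evaluation sends its limit to `f`. -/
theorem IsMetricComplete.evalHom_surjective (hM : IsMetricComplete M) :
    Function.Surjective (evalHom M).toFun := by
  intro f
  choose a ha using fun n : ℕ => evalHom_hasDenseImage f (1 / ((n : ℝ) + 1)) Nat.one_div_pos_of_nat
  have hbound (ε : ℝ) (hε : 0 < ε) :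
      ∃ N, ∀ n ≥ N, ∀ k, |(evalHom M (a n) k : ℝ) - f k| ≤ ε := by
    obtain ⟨N, hN⟩ := exists_nat_one_div_lt hε
    refine ⟨N, fun n hn => (AffineCont.emDist_le_iff hε.le).1 ?_⟩
    exact (ha n).le.trans ((Nat.one_div_le_one_div hn).trans hN.le)
  obtain ⟨x, hx⟩ := hM a fun ε hε => by
    obtain ⟨N, hN⟩ := hbound (ε / 3) (by positivity)
    refine ⟨N, fun m hm n hn => ?_⟩
    rw [← emDist_evalHom]
    refine ((AffineCont.emDist_le_iff (ε := 2 * (ε / 3)) (by positivity)).2 fun k => ?_).trans_lt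
      (by linarith)
    have h₁ := abs_le.1 (hN m hm k)
    have h₂ := abs_le.1 (hN n hn k)
    rw [abs_le]
    constructor <;> linarith [h₁.1, h₁.2, h₂.1, h₂.2]
  refine ⟨x, AffineCont.ext' fun k => sub_eq_zero.1 (abs_nonpos_iff.1 ?_)⟩
  refine le_of_forall_gt_imp_ge_of_dense fun ε hε => ?_
  obtain ⟨N₁, hN₁⟩ := hbound (ε / 2) (half_pos hε)
  obtain ⟨N₂, hN₂⟩ := hx (ε / 2) (half_pos hε)
  have h₁ := abs_le.1 (hN₁ _ (le_max_left N₁ N₂) k)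
  have h₂ := hN₂ _ (le_max_right N₁ N₂)
  rw [← emDist_evalHom] at h₂
  have h₃ := abs_le.1 ((AffineCont.emDist_le_iff (half_pos hε).le).1 h₂.le k)
  rw [abs_le]
  constructor <;> linarith [h₁.1, h₁.2, h₃.1, h₃.2]

/-- A set-theoretic right inverse is a homomorphism because evaluation is injective and reflects
sums. -/
theorem IsBanach.isIso_evalHom (hM : IsBanach M) : (evalHom M).IsIso := by
  have hemb := hM.1.evalHom_isEmbedding
  obtain ⟨g, hg⟩ := hM.2.evalHom_surjective.hasRightInverse
  refine ⟨⟨g, ?_, fun r p => ?_, fun p q t h => ?_⟩, fun x => hemb.injective (hg _), hg⟩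
  · exact hemb.injective ((hg 1).trans (evalHom M).map_one.symm)
  · refine hemb.injective ?_
    rw [hg, (evalHom M).map_smul, hg]
  · have horth : Orth (g p) (g q) := by
      refine hemb.reflects_orth _ _ ?_
      rw [hg, hg, Orth, h]
      rfl
    obtain ⟨z, hz⟩ := Option.isSome_iff_exists.1 horth
    have h' := (evalHom M).map_osum _ _ _ hz
    rw [hg, hg, h] at h'
    rw [Option.some_injective _ h', hz]
    exact congrArg some (hemb.injective (hg _).symm)

end EffectModule

theorem lemma8p4 (M : Type*) [EffectModule M] :
    EffectModule.IsBanach (AffineCont (EModState M)) ∧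
    (evalHom M).HasDenseImage ∧
    (EffectModule.IsArchimedean M → (evalHom M).IsEmbedding) ∧
    ((evalHom M).IsIso ↔ EffectModule.IsBanach M) :=
  ⟨AffineCont.isBanach, EffectModule.evalHom_hasDenseImage,
    EffectModule.IsArchimedean.evalHom_isEmbedding, EffectModule.isBanach_of_isIso_evalHom,
    EffectModule.IsBanach.isIso_evalHom⟩
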